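/- Let $w\in S_n$. Consider $n\times n$ grids, rows numbered from north to south and columns from west to east. A bumpless pipe dream (BPD) of size $n$ is a tiling of such a grid with the six tiles: blank, horizontal, vertical, cross, r-elbow (joining south and east) and j-elbow (joining west and north), such that the lines on the tiles form $n$ pipes which travel north and east, one starting in each column at the south border and one ending in each row at the east border (and no pipe touches the west or north border). Write $y\to x$ for a pipe that starts in column $y$ and ends in row $x$; two pipes that meet in a cross tile cross there. The permutation of a BPD is the $v\in S_n$ whose pipes are $v(x)\to x$ $(1\le x\le n)$. A BPD is reduced if any two of its pipes cross at most once. For a BPD $B$, let $B_K$ be the diagram obtained by traversing the pipes from the south border to the east border and replacing each cross at which the two pipes meeting there have already crossed earlier (in the diagram modified so far) by a bump tile, in which one pipe turns from west to north and the other from south to east without crossing. The type of $B$ is the $v\in S_n$ such that the pipes of $B_K$ are $v(x)\to x$ $(1\le x\le n)$. Let $\mathrm{BPD}(w)$ be the set of all BPDs of size $n$ with permutation $w$, $\mathrm{BPD}_K(w)$ the set of all BPDs of size $n$ with type $w$, and $\mathrm{bpd}(w)$ the set of all reduced BPDs of size $n$ with permutation $w$. (a) If $w$ is vexillary (that is,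 avoids the pattern $2143$), then $\mathrm{BPD}_K(w)=\mathrm{bpd}(w)$. (b) If $w$ is vexillary and also avoids the pattern $1243$, then $\mathrm{BPD}(w)=\mathrm{BPD}_K(w)=\mathrm{bpd}(w)$. -/

import Mathlib

namespace BumplessPipeDream

/-- The six tiles of a bumpless pipe dream, together with the bump tile, which only occurs after
double crossings have been resolved. Pipes are traversed from the south border to the east
border, so they move only north and east. -/
inductive Tile : Type
  /-- no pipe -/
  | blank
  /-- one pipe, from west to east -/
  | horizontal
  /-- one pipe, from south to north -/
  | vertical
  /-- two pipes, from west to east and from south to north, crossing each other -/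
  | cross
  /-- one pipe, from south to east -/
  | rElbow
  /-- one pipe, from west to north -/
  | jElbow
  /-- two pipes, from west to north and from south to east, not crossing each other -/
  | bump
  deriving DecidableEq

/-- The sides through which a pipe can enter a cell. -/
inductive Entry : Type
  | west
  | south
  deriving DecidableEq

/-- The sides through which a pipe can leave a cell. -/
inductive Exit : Type
  | north
  | east
  deriving DecidableEq

/-- The side through which a pipe that enters the tile through the given side leaves it
(`none` if the tile carries no pipe at that side). -/
def Tile.exit : Tile → Entry → Option Exit
  | .blank, _ => none
  | .horizontal, .west => some .east
  | .horizontal, .south => none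
  | .vertical, .west => none
  | .vertical, .south => some .north
  | .cross, .west => some .east
  | .cross, .south => some .north
  | .rElbow, .west => none
  | .rElbow, .south => some .east
  | .jElbow, .west => some .north
  | .jElbow, .south => none
  | .bump, .west => some .north
  | .bump, .south => some .east

/-- The tile carries a pipe at its west (south) side. -/
def Tile.Takes (t : Tile) (s : Entry) : Prop := t.exit s ≠ none

/-- The tile carries a pipe at its north (east) side. -/
def Tile.Gives (t : Tile) (e : Exit) : Prop := ∃ s, t.exit s = some e

/-- A filling of the `n × n` grid with tiles, in matrix coordinates: row `0` is the northernmost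
row and column `0` is the westernmost column. -/
abbrev Diagram (n : ℕ) : Type := Fin n → Fin n → Tile

/-- `Enters D y i j s`: the pipe of `D` that starts at the south border in column `y` enters the
cell `(i, j)` through its side `s`. -/
inductive Enters {n : ℕ} (D : Diagram n) (y : Fin n) : Fin n → Fin n → Entry → Prop
  | start {i : Fin n} (hi : (i : ℕ) + 1 = n) : Enters D y i y .south
  | goNorth {i j i' : Fin n} {s : Entry} (h : Enters D y i j s)
      (hs : (D i j).exit s = some .north) (hi : (i' : ℕ) + 1 = i) : Enters D y i' j .south
  | goEast {i j j' : Fin n} {s : Entry} (h : Enters D y i j s)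
      (hs : (D i j).exit s = some .east) (hj : (j : ℕ) + 1 = j') : Enters D y i j' .west

/-- `y → x` is a pipe of `D`: the pipe that starts at the south border in column `y` leaves the
grid through the east border in row `x`. -/
def IsPipe {n : ℕ} (D : Diagram n) (y x : Fin n) : Prop :=
  ∃ (j : Fin n) (s : Entry), (j : ℕ) + 1 = n ∧ Enters D y x j s ∧ (D x j).exit s = some .east

/-- `D` has permutation `w`: its pipes are `w x → x`. -/
def HasPerm {n : ℕ} (D : Diagram n) (w : Equiv.Perm (Fin n)) : Prop :=
  ∀ x, IsPipe D (w x) x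

/-- The pipes starting in columns `y` and `y'` cross in the cell `(i, j)`. -/
def CrossAt {n : ℕ} (D : Diagram n) (y y' i j : Fin n) : Prop :=
  D i j = .cross ∧
    ((Enters D y i j .west ∧ Enters D y' i j .south) ∨
      (Enters D y' i j .west ∧ Enters D y i j .south))

/-- The two pipes that meet in the cell `(i, j)` have crossed earlier on their way from the south
border, that is, in a cell strictly southwest of `(i, j)`. -/
def CrossedBefore {n : ℕ} (D : Diagram n) (i j : Fin n) : Prop :=
  ∃ y y', Enters D y i j .west ∧ Enters D y' i j .south ∧
    ∃ i' j', i < i' ∧ j' < j ∧ CrossAt D y y' i' j'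

/-- Bumpless pipe dreams of size `n`: tilings of the `n × n` grid with the six bumpless tiles such
that pipes match up along all inner edges, no pipe touches the west or the north border, and a
pipe starts in every column at the south border and ends in every row at the east border. -/
@[ext]
structure BPD (n : ℕ) where
  /-- the tile in each cell -/
  tile : Diagram n
  ne_bump : ∀ i j, tile i j ≠ .bump
  inner_vertical : ∀ i i' j : Fin n, (i : ℕ) + 1 = i' →
    ((tile i' j).Gives .north ↔ (tile i j).Takes .south)
  inner_horizontal : ∀ i j j' : Fin n, (j : ℕ) + 1 = j' →
    ((tile i j).Gives .east ↔ (tile i j').Takes .west)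
  west_border : ∀ i j : Fin n, (j : ℕ) = 0 → ¬ (tile i j).Takes .west
  north_border : ∀ i j : Fin n, (i : ℕ) = 0 → ¬ (tile i j).Gives .north
  south_border : ∀ i j : Fin n, (i : ℕ) + 1 = n → (tile i j).Takes .south
  east_border : ∀ i j : Fin n, (j : ℕ) + 1 = n → (tile i j).Gives .east

/-- A bumpless pipe dream is reduced if any two of its pipes cross at most once. -/
def BPD.Reduced {n : ℕ} (B : BPD n) : Prop :=
  ∀ y y' : Fin n, y ≠ y' → ∀ i j i' j' : Fin n,
    CrossAt B.tile y y' i j → CrossAt B.tile y y' i' j' → i = i' ∧ j = j'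

/-- `R` arises from `D` by traversing the pipes from the south border and turning a crossing into
a bump whenever the two pipes that meet there (in the diagram `R` obtained so far) have already
crossed. All other tiles are kept. -/
def IsResolution {n : ℕ} (D R : Diagram n) : Prop :=
  ∀ i j,
    (D i j ≠ .cross → R i j = D i j) ∧
    (D i j = .cross → CrossedBefore R i j → R i j = .bump) ∧
    (D i j = .cross → ¬ CrossedBefore R i j → R i j = .cross)

/-! The resolution exists and is unique: whether a cell is changed depends only on the cells that
pipes can traverse before it. -/

/-- Number of steps from the southwest corner of the grid. -/
def level {n : ℕ} (i j : Fin n) : ℕ := n - i + j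

theorem Enters.congr_of_level {n : ℕ} {D D' : Diagram n} {k : ℕ}
    (h : ∀ i j, level i j < k → D i j = D' i j) {y i j : Fin n} {s : Entry}
    (he : Enters D y i j s) (hk : level i j ≤ k) : Enters D' y i j s := by
  induction he with
  | start hi => exact .start hi
  | @goNorth i j i' s _ hs hi ih =>
    have h1 : level i j < k := by unfold level at *; omega
    exact .goNorth (ih h1.le) (by rw [← h _ _ h1]; exact hs) hi
  | @goEast i j j' s _ hs hj ih =>
    have h1 : level i j < k := by unfold level at *; omega
    exact .goEast (ih h1.le) (by rw [← h _ _ h1]; exact hs) hj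

theorem CrossedBefore.congr_of_level {n : ℕ} {D D' : Diagram n} {k : ℕ}
    (h : ∀ i j, level i j < k → D i j = D' i j) {i j : Fin n}
    (hc : CrossedBefore D i j) (hk : level i j ≤ k) : CrossedBefore D' i j := by
  obtain ⟨y, y', h1, h2, i', j', hi, hj, hX, hc⟩ := hc
  have hl : level i' j' < k := by unfold level at *; omega
  refine ⟨y, y', h1.congr_of_level h hk, h2.congr_of_level h hk, i', j', hi, hj, ?_, ?_⟩
  · rw [← h _ _ hl]; exact hX
  · exact hc.imp
      (fun hc => ⟨hc.1.congr_of_level h hl.le, hc.2.congr_of_level h hl.le⟩)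
      (fun hc => ⟨hc.1.congr_of_level h hl.le, hc.2.congr_of_level h hl.le⟩)

theorem crossedBefore_congr {n : ℕ} {D D' : Diagram n} {k : ℕ}
    (h : ∀ i j, level i j < k → D i j = D' i j) {i j : Fin n} (hk : level i j ≤ k) :
    CrossedBefore D i j ↔ CrossedBefore D' i j :=
  ⟨fun hc => hc.congr_of_level h hk,
    fun hc => hc.congr_of_level (fun i j hl => (h i j hl).symm) hk⟩

open Classical in
/-- The resolution carried out on the cells of level less than `k`. -/
noncomputable def resolveUpTo {n : ℕ} (D : Diagram n) : ℕ → Diagram n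
  | 0 => D
  | k + 1 => fun i j =>
      if level i j = k ∧ D i j = .cross ∧ CrossedBefore (resolveUpTo D k) i j then .bump
      else resolveUpTo D k i j

open Classical in
theorem resolveUpTo_succ {n : ℕ} (D : Diagram n) (k : ℕ) (i j : Fin n) :
    resolveUpTo D (k + 1) i j =
      if level i j = k ∧ D i j = .cross ∧ CrossedBefore (resolveUpTo D k) i j then .bump
      else resolveUpTo D k i j := rfl

theorem resolveUpTo_of_le {n : ℕ} (D : Diagram n) {k : ℕ} {i j : Fin n} (h : k ≤ level i j) :
    resolveUpTo D k i j = D i j := by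
  induction k with
  | zero => rfl
  | succ k ih =>
    rw [resolveUpTo_succ, if_neg (by omega), ih (by omega)]

theorem resolveUpTo_of_lt {n : ℕ} (D : Diagram n) {k : ℕ} {i j : Fin n} (h : level i j < k) :
    resolveUpTo D k i j = resolveUpTo D (level i j + 1) i j := by
  induction k, (Nat.succ_le_of_lt h) using Nat.le_induction with
  | base => rfl
  | succ k hk ih =>
    rw [resolveUpTo_succ, if_neg (by have := Nat.lt_of_succ_le hk; omega)]
    exact ih (Nat.lt_of_succ_le hk)

/-- The diagram obtained from `D` by replacing redundant crossings with bumps. -/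
noncomputable def resolution {n : ℕ} (D : Diagram n) : Diagram n := resolveUpTo D (2 * n)

/-- The resolution has the property that it is meant to have. -/
theorem isResolution_resolution {n : ℕ} (D : Diagram n) : IsResolution D (resolution D) := by
  intro i j
  have hl : ∀ i j : Fin n, level i j < 2 * n := fun i j => by unfold level; omega
  have key : resolution D i j = resolveUpTo D (level i j + 1) i j := resolveUpTo_of_lt D (hl i j)
  have hc : CrossedBefore (resolution D) i j ↔ CrossedBefore (resolveUpTo D (level i j)) i j := by
    refine crossedBefore_congr (k := level i j) (fun i' j' h => ?_) le_rfl
    rw [resolution, resolveUpTo_of_lt D (hl i' j'), resolveUpTo_of_lt D h]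
  rw [hc, key, resolveUpTo_succ, resolveUpTo_of_le D le_rfl]
  refine ⟨fun h => if_neg (by tauto), fun h h' => if_pos ⟨rfl, h, h'⟩, fun h h' => ?_⟩
  rw [if_neg (by tauto), h]

/-- The resolution is the only diagram with this property. -/
theorem IsResolution.eq_resolution {n : ℕ} {D R : Diagram n} (h : IsResolution D R) :
    R = resolution D := by
  have main : ∀ k, ∀ i j, level i j < k → R i j = resolution D i j := by
    intro k
    induction k with
    | zero => intro i j hk; omega
    | succ k ih =>
      intro i j hk
      have hc := crossedBefore_congr ih (Nat.lt_succ_iff.mp hk)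
      obtain ⟨a1, a2, a3⟩ := h i j
      obtain ⟨b1, b2, b3⟩ := isResolution_resolution D i j
      by_cases hX : D i j = .cross
      · by_cases hB : CrossedBefore R i j
        · rw [a2 hX hB, b2 hX (hc.1 hB)]
        · rw [a3 hX hB, b3 hX (fun h' => hB (hc.2 h'))]
      · rw [a1 hX, b1 hX]
  funext i j
  exact main _ i j (Nat.lt_succ_self _)

/-- All bumpless pipe dreams with permutation `w`. -/
def BPDWithPerm {n : ℕ} (w : Equiv.Perm (Fin n)) : Set (BPD n) :=
  {B | HasPerm B.tile w}

/-- All bumpless pipe dreams of type `w`: replacing redundant crossings with bumps yields a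
diagram with permutation `w`. -/
def BPDWithType {n : ℕ} (w : Equiv.Perm (Fin n)) : Set (BPD n) :=
  {B | HasPerm (resolution B.tile) w}

/-- All reduced bumpless pipe dreams with permutation `w`. -/
def reducedBPD {n : ℕ} (w : Equiv.Perm (Fin n)) : Set (BPD n) :=
  {B | B.Reduced ∧ HasPerm B.tile w}

/-- `w` contains the pattern `p`, given in one-line notation: some subword of `w` has its entries
in the same relative order as those of `p`. -/
def ContainsPattern {n k : ℕ} (w : Equiv.Perm (Fin n)) (p : Fin k → ℕ) : Prop :=
  ∃ f : Fin k ↪o Fin n, ∀ a b, w (f a) < w (f b) ↔ p a < p b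

/-- Vexillary permutations: those that avoid the pattern `2143`. -/
def Vexillary {n : ℕ} (w : Equiv.Perm (Fin n)) : Prop :=
  ¬ ContainsPattern w ![2, 1, 4, 3]

end BumplessPipeDream

namespace BumplessPipeDream

variable {n : ℕ} {D : Diagram n}

/-! A repeated meeting of two pipes forces an inversion of the permutation to its southeast. Suppose
two pipes meet in a cell `(i, j)` after crossing in a cell strictly southwest of it, in column `b <
j`. Both start in columns at most `b`, so the one that enters `(i, j)` from the south has turned
north in column `j`, below row `i`. Among the turns weakly southeast of that turn, choose a maximal
one. It is a j-elbow: a bump is itself a repeated meeting, so it has another turn below it. With no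
further turns to its southeast, the pipes there are hooks, and two of them form an inversion `i₁ <
i₂`, `w i₂ < w i₁` (`Consistent.exists_pipes`, `Consistent.exists_inversion`).

The two meeting pipes end in rows above `i₁` and start in columns west of `w i₂`
(`Consistent.exists_inversion_of_crossedBefore`). With the inversion they give the pattern 2143 or
1243, depending on their order. For a nonreduced BPD with permutation `w`, one of the two patterns
therefore occurs. In the resolution no two pipes cross twice, and pipes that cross exactly once are
inverted (`CrossAt.row_lt`), so only 2143 is possible. `Consistent` keeps just the conditions that a
BPD shares with its resolution, so that one argument serves both. -/

theorem Tile.exit_injective {t : Tile} {s s' : Entry} {e : Exit} (h : t.exit s = some e)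
    (h' : t.exit s' = some e) : s = s' := by
  cases t <;> cases s <;> cases s' <;> cases e <;> simp_all [Tile.exit]

/-! ### Cells on a pipe -/

theorem Enters.col_ge {y i j : Fin n} {s : Entry} (h : Enters D y i j s) : y ≤ j := by
  induction h with
  | start => exact le_rfl
  | goNorth _ _ _ ih => exact ih
  | goEast _ _ hj ih => rw [Fin.le_def] at *; omega

/-- A pipe does not enter two cells on the same diagonal. -/
theorem Enters.unique {y i j i' j' : Fin n} {s s' : Entry} (h : Enters D y i j s)
    (h' : Enters D y i' j' s') (hl : level i j = level i' j') : i = i' ∧ j = j' ∧ s = s' := by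
  induction h generalizing i' j' s' with
  | @start i hi =>
    -- A pipe never goes west of its starting column, so on the diagonal of the start cell only that
    -- cell is available.
    have hc := Fin.le_def.1 h'.col_ge
    have hi' := i'.isLt
    unfold level at hl
    have e1 : i = i' := Fin.ext (by omega)
    have e2 : y = j' := Fin.ext (by omega)
    refine ⟨e1, e2, ?_⟩
    cases h' with
    | start => rfl
    | goNorth _ _ _ => rfl
    | goEast h'' _ hj =>
      have := Fin.le_def.1 h''.col_ge
      omega
  | @goNorth i j i₁ s h hs hi ih =>
    have hc := Fin.le_def.1 h.col_ge
    have hin := i.isLt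
    cases h' with
    | start hi' => unfold level at hl; omega
    | @goNorth i₂ _ _ s₂ h'' hs' hi' =>
      obtain ⟨e1, e2, e3⟩ := ih h'' (by unfold level at *; omega)
      subst e1 e2 e3
      exact ⟨Fin.ext (by omega), rfl, rfl⟩
    | @goEast _ j₂ _ s₂ h'' hs' hj' =>
      obtain ⟨e1, e2, e3⟩ := ih h'' (by have := i'.isLt; unfold level at *; omega)
      subst e1 e2 e3
      rw [hs] at hs'
      simp at hs'
  | @goEast i j j₁ s h hs hj ih =>
    have hc := Fin.le_def.1 h.col_ge
    have hin := i.isLt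
    cases h' with
    | start hi' => unfold level at hl; omega
    | @goNorth i₂ _ _ s₂ h'' hs' hi' =>
      obtain ⟨e1, e2, e3⟩ := ih h'' (by have := i₂.isLt; unfold level at *; omega)
      subst e1 e2 e3
      rw [hs] at hs'
      simp at hs'
    | @goEast _ j₂ _ s₂ h'' hs' hj' =>
      obtain ⟨e1, e2, e3⟩ := ih h'' (by unfold level at *; omega)
      subst e1 e2 e3
      exact ⟨rfl, Fin.ext (by omega), rfl⟩

/-- Pipes travel north and east. -/
theorem Enters.mono {y i j i' j' : Fin n} {s s' : Entry} (h : Enters D y i j s)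
    (h' : Enters D y i' j' s') (hl : level i j ≤ level i' j') : i' ≤ i ∧ j ≤ j' := by
  rcases hl.eq_or_lt with heq | hlt
  · obtain ⟨rfl, rfl, -⟩ := h.unique h' heq
    exact ⟨le_rfl, le_rfl⟩
  clear hl
  have hc := Fin.le_def.1 h.col_ge
  have hin := i.isLt
  induction h' with
  | start hi => unfold level at hlt; omega
  | @goNorth i₁ j₁ i₂ s₁ h' hs hi ih =>
    have hl : level i₁ j₁ + 1 = level i₂ j₁ := by have := i₁.isLt; unfold level; omega
    have key : i₁ ≤ i ∧ j ≤ j₁ := by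
      rcases (show level i j ≤ level i₁ j₁ by omega).eq_or_lt with heq | hlt
      · obtain ⟨rfl, rfl, -⟩ := h.unique h' heq
        exact ⟨le_rfl, le_rfl⟩
      · exact ih hlt
    exact ⟨le_trans (Fin.le_def.2 (by omega)) key.1, key.2⟩
  | @goEast i₁ j₁ j₂ s₁ h' hs hj ih =>
    have hl : level i₁ j₁ + 1 = level i₁ j₂ := by unfold level; omega
    have key : i₁ ≤ i ∧ j ≤ j₁ := by
      rcases (show level i j ≤ level i₁ j₁ by omega).eq_or_lt with heq | hlt
      · obtain ⟨rfl, rfl, -⟩ := h.unique h' heq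
        exact ⟨le_rfl, le_rfl⟩
      · exact ih hlt
    exact ⟨key.1, le_trans key.2 (Fin.le_def.2 (by omega))⟩

theorem Enters.level_gt {y i j : Fin n} {s : Entry} (h : Enters D y i j s) :
    (y : ℕ) < level i j := by
  have hc := Fin.le_def.1 h.col_ge
  have hi := i.isLt
  unfold level
  omega

/-- Distinct pipes do not share an edge. -/
theorem Enters.start_unique {y y' i j : Fin n} {s : Entry} (h : Enters D y i j s)
    (h' : Enters D y' i j s) : y = y' := by
  induction h with
  | start hi =>
    cases h' with
    | start => rfl
    | @goNorth i₁ _ _ _ _ _ hi' => have := i₁.isLt; omega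
  | @goNorth i j i₁ s h hs hi ih =>
    cases h' with
    | start hi' => have := i.isLt; omega
    | @goNorth i₂ _ _ s₂ h'' hs' hi' =>
      obtain rfl : i = i₂ := Fin.ext (by omega)
      obtain rfl := Tile.exit_injective hs hs'
      exact ih h''
  | @goEast i j j₁ s h hs hj ih =>
    cases h' with
    | @goEast _ j₂ _ s₂ h'' hs' hj' =>
      obtain rfl : j = j₂ := Fin.ext (by omega)
      obtain rfl := Tile.exit_injective hs hs'
      exact ih h''

theorem IsPipe.start_unique {y y' x : Fin n} (h : IsPipe D y x) (h' : IsPipe D y' x) :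
    y = y' := by
  obtain ⟨j, s, hj, he, hs⟩ := h
  obtain ⟨j', s', hj', he', hs'⟩ := h'
  obtain rfl : j = j' := Fin.ext (by omega)
  obtain rfl := Tile.exit_injective hs hs'
  exact he.start_unique he'

/-- No cell of a pipe comes after the one in which it leaves the grid. -/
theorem Enters.level_le_of_exit {y i j i' j' : Fin n} {s s' : Entry} (h : Enters D y i j s)
    (hs : (D i j).exit s = some .east) (hj : (j : ℕ) + 1 = n) (h' : Enters D y i' j' s') :
    level i' j' ≤ level i j := by
  induction h' with
  | start hi =>
    have := h.level_gt
    unfold level at *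
    omega
  | @goNorth i₁ j₁ i₂ s₁ h' hs' hi ih =>
    have hl : level i₁ j₁ + 1 = level i₂ j₁ := by have := i₁.isLt; unfold level; omega
    by_contra hlt
    obtain ⟨rfl, rfl, rfl⟩ := h.unique h' (by omega)
    rw [hs] at hs'
    simp at hs'
  | @goEast i₁ j₁ j₂ s₁ h' hs' hj' ih =>
    have hl : level i₁ j₁ + 1 = level i₁ j₂ := by unfold level; omega
    by_contra hlt
    obtain ⟨rfl, rfl, rfl⟩ := h.unique h' (by omega)
    have := j₂.isLt
    omega

theorem IsPipe.row_le {y x i j : Fin n} {s : Entry} (h : IsPipe D y x) (h' : Enters D y i j s) :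
    x ≤ i := by
  obtain ⟨j', s', hj, he, hs⟩ := h
  exact (h'.mono he (he.level_le_of_exit hs hj h')).1

/-- Entry from the west would mean that the previous cell, one column further west, comes no earlier
than `(i, j)`, against monotonicity. -/
theorem Enters.south_of_same_col {y i i' j : Fin n} {s s' : Entry} (h : Enters D y i j s)
    (h' : Enters D y i' j s') (hi : i' < i) : s' = .south := by
  cases h' with
  | start => rfl
  | goNorth _ _ _ => rfl
  | @goEast _ j₂ _ s₂ h'' hs' hj' =>
    have hin := i.isLt
    rw [Fin.lt_def] at hi
    have := (h.mono h'' (by unfold level; omega)).2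
    rw [Fin.le_def] at this
    omega

theorem Enters.west_of_same_row {y i j j' : Fin n} {s s' : Entry} (h : Enters D y i j s)
    (h' : Enters D y i j' s') (hj : j < j') : s' = .west := by
  rw [Fin.lt_def] at hj
  cases h' with
  | start =>
    have := Fin.le_def.1 h.col_ge
    omega
  | @goNorth i₂ _ _ s₂ h'' hs' hi' =>
    have hin := i₂.isLt
    have := (h.mono h'' (by unfold level; omega)).1
    rw [Fin.le_def] at this
    omega
  | goEast _ _ _ => rfl

/-- Two distinct crossings of the same two pipes lie strictly southwest and northeast of each
other. -/
theorem CrossAt.lt_of_level_le {y y' i j i' j' : Fin n} (h : CrossAt D y y' i j)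
    (h' : CrossAt D y y' i' j') (hne : ¬ (i = i' ∧ j = j')) (hl : level i j ≤ level i' j') :
    i' < i ∧ j < j' := by
  have hy : ∃ s, Enters D y i j s := by rcases h.2 with h | h <;> exact ⟨_, by tauto⟩
  have hy' : ∃ s, Enters D y' i j s := by rcases h.2 with h | h <;> exact ⟨_, by tauto⟩
  have hz : ∃ s s', s ≠ s' ∧ Enters D y i' j' s ∧ Enters D y' i' j' s' := by
    rcases h'.2 with h | h
    · exact ⟨.west, .south, by simp, h.1, h.2⟩
    · exact ⟨.south, .west, by simp, h.2, h.1⟩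
  obtain ⟨s, hs⟩ := hy
  obtain ⟨s', hs'⟩ := hy'
  obtain ⟨t, t', hne', ht, ht'⟩ := hz
  obtain ⟨h1, h2⟩ := hs.mono ht hl
  rcases h1.eq_or_lt with rfl | h1
  -- In a common row or column, both pipes would enter the later crossing through the same side.
  · rcases h2.eq_or_lt with rfl | h2
    · exact absurd ⟨rfl, rfl⟩ hne
    · exact absurd ((hs.west_of_same_row ht h2).trans (hs'.west_of_same_row ht' h2).symm) hne'
  · rcases h2.eq_or_lt with rfl | h2
    · exact absurd ((hs.south_of_same_col ht h1).trans (hs'.south_of_same_col ht' h1).symm) hne'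
    · exact ⟨h1, h2⟩

/-! ### Turns to the north -/

/-- A pipe turns from west to north in the cell `(i, j)`. -/
def Turns (D : Diagram n) (i j : Fin n) : Prop := (D i j).exit .west = some .north

/-- A pipe that starts further west can come into column `j` only through a west side; to go on up
the column it has to turn there. -/
theorem Enters.exists_turns {y i j : Fin n} (h : Enters D y i j .south) (hy : y < j) :
    ∃ i', i < i' ∧ Turns D i' j := by
  generalize hs : Entry.south = s at h
  induction h with
  | start => exact absurd hy (lt_irrefl _)
  | @goNorth i j i₁ s h hs' hi ih =>
    have hlt : i₁ < i := Fin.lt_def.2 (by omega)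
    cases s with
    | west => exact ⟨i, hlt, hs'⟩
    | south =>
      obtain ⟨i', h1, h2⟩ := ih hy rfl
      exact ⟨i', hlt.trans h1, h2⟩
  | goEast => simp at hs

/-- The tiles match up along all inner edges, and every cell on the south (east) border carries a
pipe at its south (east) side. -/
structure Consistent (D : Diagram n) : Prop where
  inner_vertical : ∀ i i' j : Fin n, (i : ℕ) + 1 = i' →
    ((D i' j).Gives .north ↔ (D i j).Takes .south)
  inner_horizontal : ∀ i j j' : Fin n, (j : ℕ) + 1 = j' →
    ((D i j).Gives .east ↔ (D i j').Takes .west)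
  south_border : ∀ i j : Fin n, (i : ℕ) + 1 = n → (D i j).Takes .south
  east_border : ∀ i j : Fin n, (j : ℕ) + 1 = n → (D i j).Gives .east

/-! ### Pipes in regions without turns to the north -/

theorem Tile.exit_south_of_gives_north {t : Tile} (h : t.Gives .north)
    (hw : t.exit .west ≠ some .north) : t.exit .south = some .north := by
  obtain ⟨s, hs⟩ := h
  cases s with
  | west => exact absurd hs hw
  | south => exact hs

theorem Tile.exit_west_of_takes_west {t : Tile} (h : t.Takes .west)
    (hw : t.exit .west ≠ some .north) : t.exit .west = some .east := by
  unfold Tile.Takes at h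
  cases ht : t.exit .west with
  | none => exact absurd ht h
  | some e => cases e <;> simp_all

theorem Tile.exit_south_of_takes_south {t : Tile} (h : t.Takes .south)
    (hw : ¬ t.Gives .north) : t.exit .south = some .east := by
  unfold Tile.Takes at h
  cases ht : t.exit .south with
  | none => exact absurd ht h
  | some e =>
    cases e with
    | north => exact absurd ⟨_, ht⟩ hw
    | east => rfl

theorem Tile.exit_south_of_gives_east {t : Tile} (h : t.Gives .east)
    (hw : ¬ t.Takes .west) : t.exit .south = some .east := by
  obtain ⟨s, hs⟩ := h
  cases s with
  | west => exact absurd (by simp [Tile.Takes, hs]) hw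
  | south => exact hs

theorem Tile.eq_jElbow_of_exit_west {t : Tile} (h : t.exit .west = some .north)
    (hb : t ≠ .bump) : t = .jElbow := by
  cases t <;> simp [Tile.exit] at h hb ⊢

/-- Below a cell of a column without turns, a pipe comes straight from the south border. -/
theorem Consistent.enters_of_takes_south (hD : Consistent D) {j : Fin n} (m : ℕ) :
    ∀ i : Fin n, (i : ℕ) + 1 + m = n → (∀ i', i < i' → ¬ Turns D i' j) →
      (D i j).Takes .south → Enters D j i j .south := by
  induction m with
  | zero => exact fun i hi _ _ => .start hi
  | succ m ih =>
    intro i hi hT ht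
    let i' : Fin n := ⟨i + 1, by omega⟩
    have hlt : i < i' := Fin.lt_def.2 (Nat.lt_succ_self _)
    have hg := (hD.inner_vertical i i' j rfl).2 ht
    have hs := Tile.exit_south_of_gives_north hg (hT i' hlt)
    refine .goNorth (ih i' (by simp only [i']; omega) (fun k hk => hT k (hlt.trans hk)) ?_) hs rfl
    simp [Tile.Takes, hs]

/-- Along a row without turns, a pipe goes straight to the east border. -/
theorem Consistent.isPipe_of_exit_east (hD : Consistent D) {y i : Fin n} (m : ℕ) :
    ∀ (j : Fin n) (s : Entry), (j : ℕ) + 1 + m = n → (∀ j', j < j' → ¬ Turns D i j') →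
      Enters D y i j s → (D i j).exit s = some .east → IsPipe D y i := by
  induction m with
  | zero => exact fun j s hj _ he hs => ⟨j, s, hj, he, hs⟩
  | succ m ih =>
    intro j s hj hT he hs
    let j' : Fin n := ⟨j + 1, by omega⟩
    have hlt : j < j' := Fin.lt_def.2 (Nat.lt_succ_self _)
    have ht := (hD.inner_horizontal i j j' rfl).1 ⟨s, hs⟩
    exact ih j' .west (by simp only [j']; omega) (fun k hk => hT k (hlt.trans hk))
      (.goEast he hs rfl) (Tile.exit_west_of_takes_west ht (hT j' hlt))

/-- Southeast of a last elbow that joins west and north, two pipes form an inversion. -/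
theorem Consistent.exists_pipes (hD : Consistent D) {i j : Fin n} (hJ : D i j = .jElbow)
    (hmax : ∀ i' j', i ≤ i' → j ≤ j' → Turns D i' j' → i' = i ∧ j' = j) :
    ∃ i' j', i < i' ∧ j < j' ∧ IsPipe D j' i ∧ IsPipe D j i' := by
  classical
  -- The first cell east of the elbow with a pipe at its east side receives none from the west. Its
  -- pipe comes from the south and, as no turns are left, is a hook with its corner there.
  have hcol : ∃ j', j < j' ∧ IsPipe D j' i := by
    let S : Finset (Fin n) := Finset.univ.filter fun k => j < k ∧ (D i k).Gives .east
    have hn := j.isLt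
    let e : Fin n := ⟨n - 1, by omega⟩
    have hg := hD.east_border i e (by simp only [e]; omega)
    have hS : S.Nonempty := by
      refine ⟨e, Finset.mem_filter.2 ⟨Finset.mem_univ _, lt_of_le_of_ne ?_ ?_, hg⟩⟩
      · rw [Fin.le_def]; simp only [e]; omega
      · rintro h
        rw [← h, hJ] at hg
        obtain ⟨s, hs⟩ := hg
        cases s <;> simp [Tile.exit] at hs
    obtain ⟨k, hk, hmin⟩ := S.exists_minimal hS
    obtain ⟨-, hjk, hgk⟩ := Finset.mem_filter.1 hk
    have hjk' := Fin.lt_def.1 hjk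
    have hkn := k.isLt
    have hT : ∀ i' j', i ≤ i' → k ≤ j' → ¬ Turns D i' j' := fun i' j' h1 h2 h3 =>
      absurd (hmax i' j' h1 (hjk.le.trans h2) h3).2 (ne_of_gt (hjk.trans_le h2))
    have hw : ¬ (D i k).Takes .west := by
      let k' : Fin n := ⟨k - 1, by omega⟩
      have hk' : (k' : ℕ) + 1 = k := by simp only [k']; omega
      rw [← hD.inner_horizontal i k' k hk']
      intro hg'
      have hlt : k' < k := Fin.lt_def.2 (by omega)
      rcases (show j ≤ k' from Fin.le_def.2 (by omega)).eq_or_lt with h | h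
      · rw [← h, hJ] at hg'
        obtain ⟨s, hs⟩ := hg'
        cases s <;> simp [Tile.exit] at hs
      · exact absurd (hmin (Finset.mem_filter.2 ⟨Finset.mem_univ _, h, hg'⟩) hlt.le)
          (not_le.2 hlt)
    have hs := Tile.exit_south_of_gives_east hgk hw
    have hin := i.isLt
    refine ⟨k, hjk, hD.isPipe_of_exit_east (n - 1 - k) k .south (by omega)
      (fun j' h => hT i j' le_rfl h.le)
      (hD.enters_of_takes_south (n - 1 - i) i (by omega) (fun i' h => hT i' k h.le le_rfl) ?_) hs⟩
    simp [Tile.Takes, hs]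
  -- Likewise the first cell below the elbow with a pipe at its south side passes none to the north,
  -- so it is the corner of a hook.
  have hrow : ∃ i', i < i' ∧ IsPipe D j i' := by
    let S : Finset (Fin n) := Finset.univ.filter fun k => i < k ∧ (D k j).Takes .south
    have hn := i.isLt
    let e : Fin n := ⟨n - 1, by omega⟩
    have hg := hD.south_border e j (by simp only [e]; omega)
    have hS : S.Nonempty := by
      refine ⟨e, Finset.mem_filter.2 ⟨Finset.mem_univ _, lt_of_le_of_ne ?_ ?_, hg⟩⟩
      · rw [Fin.le_def]; simp only [e]; omega
      · rintro h
        rw [← h, hJ] at hg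
        simp [Tile.Takes, Tile.exit] at hg
    obtain ⟨k, hk, hmin⟩ := S.exists_minimal hS
    obtain ⟨-, hjk, hgk⟩ := Finset.mem_filter.1 hk
    have hjk' := Fin.lt_def.1 hjk
    have hkn := k.isLt
    have hT : ∀ i' j', k ≤ i' → j ≤ j' → ¬ Turns D i' j' := fun i' j' h1 h2 h3 =>
      absurd (hmax i' j' (hjk.le.trans h1) h2 h3).1 (ne_of_gt (hjk.trans_le h1))
    have hw : ¬ (D k j).Gives .north := by
      let k' : Fin n := ⟨k - 1, by omega⟩
      have hk' : (k' : ℕ) + 1 = k := by simp only [k']; omega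
      rw [hD.inner_vertical k' k j hk']
      intro hg'
      have hlt : k' < k := Fin.lt_def.2 (by omega)
      rcases (show i ≤ k' from Fin.le_def.2 (by omega)).eq_or_lt with h | h
      · rw [← h, hJ] at hg'
        simp [Tile.Takes, Tile.exit] at hg'
      · exact absurd (hmin (Finset.mem_filter.2 ⟨Finset.mem_univ _, h, hg'⟩) hlt.le)
          (not_le.2 hlt)
    have hs := Tile.exit_south_of_takes_south hgk hw
    have hjn := j.isLt
    exact ⟨k, hjk, hD.isPipe_of_exit_east (n - 1 - j) j .south (by omega)
      (fun j' h => hT k j' le_rfl h.le)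
      (hD.enters_of_takes_south (n - 1 - k) k (by omega) (fun i' h => hT i' j h.le le_rfl) hgk) hs⟩
  obtain ⟨j', h1, h2⟩ := hcol
  obtain ⟨i', h3, h4⟩ := hrow
  exact ⟨i', j', h3, h1, h2, h4⟩

/-- Every turn to the north has an inversion of the permutation weakly to its southeast. -/
theorem Consistent.exists_inversion (hD : Consistent D)
    (hb : ∀ i j, D i j = .bump → ∃ i', i < i' ∧ Turns D i' j) {w : Equiv.Perm (Fin n)}
    (hw : HasPerm D w) {i j : Fin n} (hT : Turns D i j) :
    ∃ i₁ i₂, i ≤ i₁ ∧ i₁ < i₂ ∧ j ≤ w i₂ ∧ w i₂ < w i₁ := by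
  classical
  let S : Finset (Fin n × Fin n) :=
    Finset.univ.filter fun c => i ≤ c.1 ∧ j ≤ c.2 ∧ Turns D c.1 c.2
  obtain ⟨⟨a, b⟩, hab, hmax⟩ := S.exists_maximal
    ⟨(i, j), Finset.mem_filter.2 ⟨Finset.mem_univ _, le_rfl, le_rfl, hT⟩⟩
  obtain ⟨-, hia, hjb, hTab⟩ := Finset.mem_filter.1 hab
  have hmax' : ∀ i' j', a ≤ i' → b ≤ j' → Turns D i' j' → i' = a ∧ j' = b := by
    intro i' j' h1 h2 h3
    have := hmax (Finset.mem_filter.2 ⟨Finset.mem_univ (i', j'), hia.trans h1, hjb.trans h2, h3⟩)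
      (Prod.mk_le_mk.2 ⟨h1, h2⟩)
    obtain ⟨h4, h5⟩ := Prod.mk_le_mk.1 this
    exact ⟨le_antisymm h4 h1, le_antisymm h5 h2⟩
  have hJ : D a b = .jElbow := by
    -- The turn below a bump in its column would contradict maximality.
    have hnb : D a b ≠ .bump := by
      intro h
      obtain ⟨a', h1, h2⟩ := hb a b h
      exact absurd (hmax' a' b h1.le le_rfl h2).1 h1.ne'
    exact Tile.eq_jElbow_of_exit_west hTab hnb
  obtain ⟨a', b', h1, h2, h3, h4⟩ := hD.exists_pipes hJ hmax'
  have e1 : w a = b' := (hw a).start_unique h3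
  have e2 : w a' = b := (hw a').start_unique h4
  exact ⟨a, a', hia, h1, by rw [e2]; exact hjb, by rw [e1, e2]; exact h2⟩

/-! ### The order of two pipes along a diagonal -/

/-- Position of an edge along a diagonal, increasing from northwest to southeast. -/
def edgePos (j : Fin n) : Entry → ℕ
  | .west => 2 * j
  | .south => 2 * j + 1

theorem Enters.exists_prev {y i j : Fin n} {s : Entry} {k : ℕ} (h : Enters D y i j s)
    (hk : level i j = k + 1) (hy : (y : ℕ) < k) :
    ∃ i₀ j₀ s₀, Enters D y i₀ j₀ s₀ ∧ level i₀ j₀ = k ∧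
      (((D i₀ j₀).exit s₀ = some .north ∧ (i : ℕ) + 1 = i₀ ∧ j = j₀ ∧ s = .south) ∨
        ((D i₀ j₀).exit s₀ = some .east ∧ i = i₀ ∧ (j₀ : ℕ) + 1 = j ∧ s = .west)) := by
  cases h with
  | start hi => unfold level at hk; omega
  | @goNorth i₀ _ _ s₀ h hs hi =>
    exact ⟨i₀, j, s₀, h, by have := i₀.isLt; unfold level at *; omega, .inl ⟨hs, hi, rfl, rfl⟩⟩
  | @goEast _ j₀ _ s₀ h hs hj =>
    exact ⟨i, j₀, s₀, h, by unfold level at *; omega, .inr ⟨hs, rfl, hj, rfl⟩⟩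

theorem Enters.exists_at_level {y i j : Fin n} {s : Entry} (h : Enters D y i j s) {k : ℕ}
    (hy : (y : ℕ) < k) (hk : k ≤ level i j) :
    ∃ i' j' s', Enters D y i' j' s' ∧ level i' j' = k := by
  induction hm : level i j - k generalizing i j s with
  | zero => exact ⟨i, j, s, h, by omega⟩
  | succ m ih =>
    obtain ⟨i₀, j₀, s₀, h₀, hl, -⟩ := h.exists_prev (k := level i j - 1) (by omega) (by omega)
    exact ih h₀ (by omega) (by omega)

/-- One step of two pipes that do not cross in it preserves their order. -/
theorem edgePos_lt_step {i₀ j₀ i j a₀ b₀ a b : Fin n} {s₀ s t₀ t : Entry}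
    (hl : level i₀ j₀ = level a₀ b₀)
    (h : ((D i₀ j₀).exit s₀ = some .north ∧ (i : ℕ) + 1 = i₀ ∧ j = j₀ ∧ s = .south) ∨
        ((D i₀ j₀).exit s₀ = some .east ∧ i = i₀ ∧ (j₀ : ℕ) + 1 = j ∧ s = .west))
    (h' : ((D a₀ b₀).exit t₀ = some .north ∧ (a : ℕ) + 1 = a₀ ∧ b = b₀ ∧ t = .south) ∨
        ((D a₀ b₀).exit t₀ = some .east ∧ a = a₀ ∧ (b₀ : ℕ) + 1 = b ∧ t = .west))
    (hlt : edgePos j₀ s₀ < edgePos b₀ t₀)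
    (hX : ¬ (i₀ = a₀ ∧ j₀ = b₀ ∧ D i₀ j₀ = .cross)) : edgePos j s < edgePos b t := by
  have hi₀ := i₀.isLt
  have ha₀ := a₀.isLt
  by_cases hc : (j₀ : ℕ) = b₀
  · obtain rfl : j₀ = b₀ := Fin.ext hc
    obtain rfl : i₀ = a₀ := Fin.ext (by unfold level at hl; omega)
    obtain ⟨rfl, rfl⟩ : s₀ = .west ∧ t₀ = .south := by
      cases s₀ <;> cases t₀ <;> simp [edgePos] at hlt ⊢
    have hX : D i₀ j₀ ≠ .cross := fun h => hX ⟨rfl, rfl, h⟩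
    -- Only a bump remains: the pipe from the west moves to position `2 * j₀ + 1`, the one from the
    -- south to `2 * j₀ + 2`.
    cases hD : D i₀ j₀ <;> simp_all [Tile.exit]
    obtain ⟨-, -, rfl⟩ := h
    obtain ⟨-, hb, rfl⟩ := h'
    simp only [edgePos]; omega
  · have hc : (j₀ : ℕ) < b₀ := by
      cases s₀ <;> cases t₀ <;> simp only [edgePos] at hlt <;> omega
    rcases h with ⟨-, h1, h2, rfl⟩ | ⟨-, h1, h2, rfl⟩ <;>
    rcases h' with ⟨-, h1', h2', rfl⟩ | ⟨-, h1', h2', rfl⟩ <;>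
    simp only [edgePos] <;> subst_vars <;> omega

theorem CrossAt.of_enters {y y' i j : Fin n} {s s' : Entry} (h : Enters D y i j s)
    (h' : Enters D y' i j s') (hne : y ≠ y') (hX : D i j = .cross) : CrossAt D y y' i j := by
  refine ⟨hX, ?_⟩
  cases s <;> cases s'
  · exact absurd (h.start_unique h') hne
  · exact .inl ⟨h, h'⟩
  · exact .inr ⟨h', h⟩
  · exact absurd (h.start_unique h') hne

/-- Pipes keep their order as long as they do not cross. -/
theorem edgePos_lt_of_level_le {y y' : Fin n} (hne : y ≠ y') {k : ℕ} (hy : (y : ℕ) < k)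
    (hy' : (y' : ℕ) < k)
    (hk : ∀ i j s i' j' s', Enters D y i j s → Enters D y' i' j' s' → level i j = k →
      level i' j' = k → edgePos j s < edgePos j' s')
    (l : ℕ) (hl : k ≤ l) (hX : ∀ i j, k ≤ level i j → level i j < l → ¬ CrossAt D y y' i j) :
    ∀ i j s i' j' s', Enters D y i j s → Enters D y' i' j' s' → level i j = l →
      level i' j' = l → edgePos j s < edgePos j' s' := by
  induction l, hl using Nat.le_induction with
  | base => exact hk
  | succ l hl ih =>
    intro i j s i' j' s' h h' e e'
    obtain ⟨i₀, j₀, s₀, h₀, e₀, hst⟩ := h.exists_prev e (by omega)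
    obtain ⟨a₀, b₀, t₀, h₀', e₀', hst'⟩ := h'.exists_prev e' (by omega)
    refine edgePos_lt_step (D := D) (by omega) hst hst'
      (ih (fun i j h1 h2 => hX i j h1 (by omega)) _ _ _ _ _ _ h₀ h₀' e₀ e₀') ?_
    rintro ⟨rfl, rfl, hc⟩
    exact hX i₀ j₀ (by omega) (by omega) (.of_enters h₀ h₀' hne hc)

theorem edgePos_lt_of_not_crossAt {y y' : Fin n} (hlt : y < y') {l : ℕ}
    (hX : ∀ i j, level i j < l → ¬ CrossAt D y y' i j)
    {i j i' j' : Fin n} {s s' : Entry} (h : Enters D y i j s) (h' : Enters D y' i' j' s')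
    (e : level i j = l) (e' : level i' j' = l) : edgePos j s < edgePos j' s' := by
  have hlt' := Fin.lt_def.1 hlt
  have hl := h'.level_gt
  -- The comparison begins at level `y' + 1`, that of the start cell of the second pipe. This cell
  -- is the southeast end of its diagonal.
  refine edgePos_lt_of_level_le (k := y' + 1) hlt.ne (by omega) (by omega) ?_ l (by omega)
    (fun i j _ h => hX i j h) _ _ _ _ _ _ h h' e e'
  intro i j s i' j' s' h h' e e'
  have h1 := i.isLt
  have h2 := i'.isLt
  have h3 := Fin.le_def.1 h'.col_ge
  unfold level at e e'
  have hst : Enters D y' i' y' .south := .start (by omega)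
  obtain ⟨-, rfl, rfl⟩ := hst.unique h' (by unfold level; omega)
  by_cases hj : (j : ℕ) = y'
  · obtain rfl : j = y' := Fin.ext hj
    obtain rfl : i = i' := Fin.ext (by omega)
    cases s with
    | west => simp [edgePos]
    | south => exact absurd (h.start_unique h') hlt.ne
  · cases s <;> simp only [edgePos] <;> omega

/-- Two pipes that cross exactly once form an inversion. -/
theorem CrossAt.row_lt {y y' x x' i j : Fin n} (hlt : y < y') (hc : CrossAt D y y' i j)
    (huniq : ∀ i' j', CrossAt D y y' i' j' → i' = i ∧ j' = j) (hx : IsPipe D y x)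
    (hx' : IsPipe D y' x') : x' < x := by
  -- Up to the only crossing, the pipe from `y` stays northwest of the other, so it arrives from the
  -- west.
  have hent : Enters D y i j .west ∧ Enters D y' i j .south := by
    rcases hc.2 with h | h
    · exact h
    · have := edgePos_lt_of_not_crossAt hlt (l := level i j)
        (fun a b hl hab => by obtain ⟨rfl, rfl⟩ := huniq a b hab; omega) h.2 h.1 rfl rfl
      simp only [edgePos] at this
      omega
  obtain ⟨h1, h2⟩ := hent
  obtain ⟨b, s, hb, hy, hs⟩ := hx
  obtain ⟨b', s', hb', hy', hs'⟩ := hx'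
  obtain rfl : b = b' := Fin.ext (by omega)
  by_contra hle
  rw [not_lt] at hle
  have hxn := x.isLt
  have hxn' := x'.isLt
  have hm := hy'.level_le_of_exit hs' hb' h2
  have hm' : level i j < level x' b := by
    rcases hm.eq_or_lt with h | h
    · obtain ⟨rfl, rfl, rfl⟩ := h2.unique hy' h
      rw [hc.1] at hs'
      simp [Tile.exit] at hs'
    · exact h
  -- From the level after the crossing on, the order is reversed for good.
  have hord := edgePos_lt_of_level_le (D := D) (y := y') (y' := y) (k := level i j + 1) hlt.ne'
    (by have := h2.level_gt; omega) (by have := h1.level_gt; omega)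
    (by
      intro i₁ j₁ s₁ i₂ j₂ s₂ g g' e e'
      obtain ⟨i₀, j₀, s₀, h₀, e₀, hst⟩ := g.exists_prev e h2.level_gt
      obtain ⟨a₀, b₀, t₀, h₀', e₀', hst'⟩ := g'.exists_prev e' h1.level_gt
      obtain ⟨rfl, rfl, rfl⟩ := h2.unique h₀ e₀.symm
      obtain ⟨rfl, rfl, rfl⟩ := h1.unique h₀' e₀'.symm
      simp only [hc.1, Tile.exit, Option.some.injEq, reduceCtorEq, false_and, or_false,
        false_or, true_and] at hst hst'
      obtain ⟨-, rfl, rfl⟩ := hst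
      obtain ⟨-, h, rfl⟩ := hst'
      simp only [edgePos]
      omega)
    (level x' b) hm' (fun a c hl _ hac => by
      obtain ⟨rfl, rfl⟩ := huniq a c ⟨hac.1, hac.2.symm⟩
      omega)
  have hne : (x : ℕ) ≠ x' := by
    intro h
    obtain rfl := Fin.ext h
    obtain rfl := Tile.exit_injective hs hs'
    exact hlt.ne (hy.start_unique hy')
  rw [Fin.le_def] at hle
  have hL : level x' b < level x b := by unfold level; omega
  obtain ⟨i₁, j₁, s₁, g₁, e₁⟩ := hy.exists_at_level (k := level x' b + 1)
    (by have := h1.level_gt; omega) hL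
  obtain ⟨i₀, j₀, s₀, g₀, e₀, hst⟩ := g₁.exists_prev e₁ (by have := h1.level_gt; omega)
  -- When the pipe from `y'` leaves the grid, the other lies southeast of it on the same diagonal.
  -- In the last column this means the same cell, entered from the south. Having a step left, it
  -- goes north, which makes the cell a second crossing.
  have ho := hord _ _ _ _ _ _ hy' g₀ rfl e₀
  have hj₀ := j₀.isLt
  obtain ⟨hjb, rfl, rfl⟩ : (j₀ : ℕ) = b ∧ s' = .west ∧ s₀ = .south := by
    cases s' <;> cases s₀ <;> simp only [edgePos] at ho <;> simp <;> omega
  obtain rfl := Fin.ext hjb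
  obtain rfl : i₀ = x' := Fin.ext (by have := i₀.isLt; unfold level at e₀; omega)
  have hX : D i₀ j₀ = .cross := by
    rcases hst with ⟨h, -⟩ | ⟨h, -, h', -⟩
    · cases hD : D i₀ j₀ <;> simp_all [Tile.exit]
    · have := j₁.isLt
      omega
  obtain ⟨rfl, rfl⟩ := huniq i₀ j₀ ⟨hX, .inr ⟨hy', g₀⟩⟩
  omega

/-! ### Bumpless pipe dreams and their resolutions -/

theorem BPD.consistent (B : BPD n) : Consistent B.tile :=
  ⟨B.inner_vertical, B.inner_horizontal, B.south_border, B.east_border⟩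

theorem Tile.gives_bump_iff (e : Exit) : Tile.bump.Gives e ↔ Tile.cross.Gives e := by
  cases e
  · exact ⟨fun _ => ⟨.south, rfl⟩, fun _ => ⟨.west, rfl⟩⟩
  · exact ⟨fun _ => ⟨.west, rfl⟩, fun _ => ⟨.south, rfl⟩⟩

theorem Tile.takes_bump_iff (s : Entry) : Tile.bump.Takes s ↔ Tile.cross.Takes s := by
  cases s <;> simp [Tile.Takes, Tile.exit]

theorem IsResolution.eq_or {D R : Diagram n} (h : IsResolution D R) (i j : Fin n) :
    R i j = D i j ∨ (D i j = .cross ∧ R i j = .bump ∧ CrossedBefore R i j) := by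
  obtain ⟨h1, h2, h3⟩ := h i j
  by_cases hX : D i j = .cross
  · by_cases hc : CrossedBefore R i j
    · exact .inr ⟨hX, h2 hX hc, hc⟩
    · exact .inl (by rw [h3 hX hc, hX])
  · exact .inl (h1 hX)

/-- Crosses and bumps both carry pipes at all four sides, so the matching of tiles is unaffected. -/
theorem IsResolution.consistent {D R : Diagram n} (h : IsResolution D R) (hD : Consistent D) :
    Consistent R := by
  have hg : ∀ i j e, (R i j).Gives e ↔ (D i j).Gives e := by
    intro i j e
    rcases h.eq_or i j with h | ⟨h1, h2, -⟩
    · rw [h]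
    · rw [h1, h2, Tile.gives_bump_iff]
  have ht : ∀ i j s, (R i j).Takes s ↔ (D i j).Takes s := by
    intro i j e
    rcases h.eq_or i j with h | ⟨h1, h2, -⟩
    · rw [h]
    · rw [h1, h2, Tile.takes_bump_iff]
  constructor <;> intros <;> simp only [hg, ht]
  · exact hD.inner_vertical _ _ _ ‹_›
  · exact hD.inner_horizontal _ _ _ ‹_›
  · exact hD.south_border _ _ ‹_›
  · exact hD.east_border _ _ ‹_›

theorem BPD.crossedBefore_of_bump (B : BPD n) {i j : Fin n}
    (h : resolution B.tile i j = .bump) : CrossedBefore (resolution B.tile) i j := by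
  rcases (isResolution_resolution B.tile).eq_or i j with h' | ⟨-, -, h'⟩
  · exact absurd (h'.symm.trans h) (B.ne_bump i j)
  · exact h'

theorem CrossedBefore.of_crossAt {i j y y' i' j' : Fin n} (h : CrossAt D y y' i j)
    (h' : CrossAt D y y' i' j') (hi : i' < i) (hj : j < j') : CrossedBefore D i' j' := by
  rcases h'.2 with ⟨h1, h2⟩ | ⟨h1, h2⟩
  · exact ⟨y, y', h1, h2, i, j, hi, hj, h⟩
  · exact ⟨y', y, h1, h2, i, j, hi, hj, h.1, h.2.symm⟩

/-- A diagram in which two pipes cross twice has a crossing of two pipes that have crossed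
before. -/
theorem exists_crossedBefore {y y' i j i' j' : Fin n} (h : CrossAt D y y' i j)
    (h' : CrossAt D y y' i' j') (hne : ¬ (i = i' ∧ j = j')) :
    ∃ a b, D a b = .cross ∧ CrossedBefore D a b := by
  rcases le_total (level i j) (level i' j') with hl | hl
  · obtain ⟨h1, h2⟩ := h.lt_of_level_le h' hne hl
    exact ⟨i', j', h'.1, .of_crossAt h h' h1 h2⟩
  · obtain ⟨h1, h2⟩ := h'.lt_of_level_le h (fun e => hne ⟨e.1.symm, e.2.symm⟩) hl
    exact ⟨i, j, h.1, .of_crossAt h' h h1 h2⟩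

theorem BPD.not_crossedBefore_resolution (B : BPD n) {i j : Fin n}
    (h : resolution B.tile i j = .cross) : ¬ CrossedBefore (resolution B.tile) i j := by
  intro hc
  obtain ⟨h1, h2, -⟩ := isResolution_resolution B.tile i j
  by_cases hX : B.tile i j = .cross
  · rw [h2 hX hc] at h
    simp at h
  · exact hX ((h1 hX).symm.trans h)

/-- A reduced BPD satisfies the defining property of its own resolution, which is unique. -/
theorem BPD.Reduced.resolution_eq {B : BPD n} (hB : B.Reduced) : resolution B.tile = B.tile := by
  refine (IsResolution.eq_resolution fun i j => ⟨fun _ => rfl, fun hX hc => ?_, fun hX _ => hX⟩).symm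
  obtain ⟨y, y', h1, h2, i', j', hi, hj, hc⟩ := hc
  have hne : y ≠ y' := by
    rintro rfl
    have := h1.unique h2 rfl
    simp at this
  exact absurd (hB y y' hne _ _ _ _ hc ⟨hX, .inl ⟨h1, h2⟩⟩).1 hi.ne'

theorem BPD.exists_crossedBefore_of_not_reduced {B : BPD n} (hB : ¬ B.Reduced) :
    ∃ i j, B.tile i j = .cross ∧ CrossedBefore B.tile i j := by
  unfold BPD.Reduced at hB
  push Not at hB
  obtain ⟨y, y', -, i, j, i', j', h1, h2, h3⟩ := hB
  exact exists_crossedBefore h1 h2 fun h => h3 h.1 h.2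

/-- Without bumps the resolution would be `B` itself, and a repeated crossing of `B` would have
survived in it. -/
theorem BPD.exists_bump_of_not_reduced {B : BPD n} (hB : ¬ B.Reduced) :
    ∃ i j, resolution B.tile i j = .bump := by
  by_contra hno
  have heq : resolution B.tile = B.tile := by
    funext i j
    rcases (isResolution_resolution B.tile).eq_or i j with h | ⟨-, h, -⟩
    · exact h
    · exact absurd ⟨i, j, h⟩ hno
  obtain ⟨i, j, hX, hc⟩ := B.exists_crossedBefore_of_not_reduced hB
  rw [← heq] at hX hc
  exact B.not_crossedBefore_resolution hX hc

/-- Two pipes that meet again after a crossing have an inversion to their southeast. -/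
theorem Consistent.exists_inversion_of_crossedBefore (hD : Consistent D)
    (hb : ∀ i j, D i j = .bump → CrossedBefore D i j) {w : Equiv.Perm (Fin n)}
    (hw : HasPerm D w) {i j : Fin n} (hc : CrossedBefore D i j) :
    ∃ x x' i' j' i₁ i₂, CrossAt D (w x) (w x') i' j' ∧ w x < w x' ∧ x < i₁ ∧ x' < i₁ ∧ i₁ < i₂ ∧
      w x' < w i₂ ∧ w i₂ < w i₁ := by
  have turn : ∀ i j, CrossedBefore D i j → ∃ i', i < i' ∧ Turns D i' j := by
    rintro i j ⟨y, y', -, h2, i', j', -, hj, -, hX⟩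
    refine h2.exists_turns (lt_of_le_of_lt ?_ hj)
    rcases hX with h | h
    · exact h.2.col_ge
    · exact h.1.col_ge
  obtain ⟨i', hi', hT⟩ := turn i j hc
  obtain ⟨i₁, i₂, h1, h2, h3, h4⟩ := hD.exists_inversion (fun i j h => turn i j (hb i j h)) hw hT
  -- The pipes are named so that `y < y'`. They end in rows at most `i`, above the inversion, and
  -- start in columns at most `b`, west of it.
  have main : ∀ y y' a b (s s' : Entry), b < j → Enters D y i j s → Enters D y' i j s' →
      CrossAt D y y' a b → y < y' → ∃ x x' i' j' i₁ i₂, CrossAt D (w x) (w x') i' j' ∧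
        w x < w x' ∧ x < i₁ ∧ x' < i₁ ∧ i₁ < i₂ ∧ w x' < w i₂ ∧ w i₂ < w i₁ := by
    intro y y' a b s s' hbj g g' hX hlt
    have hp := hw (w.symm y)
    have hp' := hw (w.symm y')
    rw [Equiv.apply_symm_apply] at hp hp'
    have hy' : y' ≤ b := by
      rcases hX.2 with h | h
      · exact h.2.col_ge
      · exact h.1.col_ge
    refine ⟨w.symm y, w.symm y', a, b, i₁, i₂, ?_, ?_, ?_, ?_, h2, ?_, h4⟩
    · simpa using hX
    · simpa using hlt
    · exact (hp.row_le g).trans_lt (hi'.trans_le h1)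
    · exact (hp'.row_le g').trans_lt (hi'.trans_le h1)
    · simpa using (hy'.trans_lt hbj).trans_le h3
  obtain ⟨y, y', g, g', a, b, -, hbj, hX⟩ := hc
  rcases lt_trichotomy y y' with h | h | h
  · exact main y y' a b _ _ hbj g g' hX h
  · subst h
    have := g.unique g' rfl
    simp at this
  · exact main y' y a b _ _ hbj g' g ⟨hX.1, hX.2.symm⟩ h

/-! ### Forbidden patterns and reducedness -/

theorem containsPattern_four {w : Equiv.Perm (Fin n)} {a b c d : Fin n} {p : Fin 4 → ℕ}
    (hab : a < b) (hbc : b < c) (hcd : c < d)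
    (h : ∀ k l, w (![a, b, c, d] k) < w (![a, b, c, d] l) ↔ p k < p l) :
    ContainsPattern w p := by
  refine ⟨OrderEmbedding.ofStrictMono ![a, b, c, d] ?_, h⟩
  rw [Fin.strictMono_iff_lt_succ]
  intro k
  fin_cases k <;> simp [hab, hbc, hcd]

theorem containsPattern_2143 {w : Equiv.Perm (Fin n)} {a b c d : Fin n}
    (hab : a < b) (hbc : b < c) (hcd : c < d) (h1 : w b < w a) (h2 : w a < w d)
    (h3 : w d < w c) : ContainsPattern w ![2, 1, 4, 3] := by
  refine containsPattern_four hab hbc hcd fun k l => ?_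
  fin_cases k <;> fin_cases l <;> simp <;> order

theorem containsPattern_1243 {w : Equiv.Perm (Fin n)} {a b c d : Fin n}
    (hab : a < b) (hbc : b < c) (hcd : c < d) (h1 : w a < w b) (h2 : w b < w d)
    (h3 : w d < w c) : ContainsPattern w ![1, 2, 4, 3] := by
  refine containsPattern_four hab hbc hcd fun k l => ?_
  fin_cases k <;> fin_cases l <;> simp <;> order

/-- A bumpless pipe dream of vexillary type is reduced. -/
theorem BPD.reduced_of_vexillary_type {B : BPD n} {w : Equiv.Perm (Fin n)}
    (hB : HasPerm (resolution B.tile) w) (hw : Vexillary w) : B.Reduced := by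
  by_contra hred
  obtain ⟨i, j, hb⟩ := B.exists_bump_of_not_reduced hred
  have hcons := (isResolution_resolution B.tile).consistent B.consistent
  obtain ⟨x, x', i', j', i₁, i₂, hX, h1, h2, h3, h4, h5, h6⟩ :=
    hcons.exists_inversion_of_crossedBefore (fun _ _ => B.crossedBefore_of_bump) hB
      (B.crossedBefore_of_bump hb)
  -- The resolution has no repeated crossings, so this pair crosses exactly once and is itself
  -- inverted.
  have hx : x' < x := hX.row_lt h1 (fun a b hab => by
    by_contra hne
    obtain ⟨c, d, hc, hcd⟩ := exists_crossedBefore hab hX hne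
    exact B.not_crossedBefore_resolution hc hcd) (hB x) (hB x')
  exact hw (containsPattern_2143 hx h2 h4 h1 h5 h6)

/-- A bumpless pipe dream is reduced if its permutation avoids `2143` and `1243`. -/
theorem BPD.reduced_of_perm_avoids {B : BPD n} {w : Equiv.Perm (Fin n)} (hB : HasPerm B.tile w)
    (hw : Vexillary w) (hw' : ¬ ContainsPattern w ![1, 2, 4, 3]) : B.Reduced := by
  by_contra hred
  obtain ⟨i, j, -, hc⟩ := B.exists_crossedBefore_of_not_reduced hred
  obtain ⟨x, x', i', j', i₁, i₂, -, h1, h2, h3, h4, h5, h6⟩ :=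
    B.consistent.exists_inversion_of_crossedBefore
      (fun i j h => absurd h (B.ne_bump i j)) hB hc
  -- Before resolving, the two pipes may cross several times, so their end rows can come in either
  -- order; each order gives one of the patterns.
  rcases lt_trichotomy x x' with h | rfl | h
  · exact hw' (containsPattern_1243 h h3 h4 h1 h5 h6)
  · exact lt_irrefl _ h1
  · exact hw (containsPattern_2143 h h2 h4 h1 h5 h6)

theorem BPDWithType_eq_reducedBPD {w : Equiv.Perm (Fin n)} (hw : Vexillary w) :
    BPDWithType w = reducedBPD w := by
  ext B
  constructor
  · intro h
    have hr := BPD.reduced_of_vexillary_type h hw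
    have h' : HasPerm (resolution B.tile) w := h
    exact ⟨hr, hr.resolution_eq ▸ h'⟩
  · rintro ⟨hr, h⟩
    change HasPerm (resolution B.tile) w
    rwa [hr.resolution_eq]

theorem BPDWithPerm_eq_reducedBPD {w : Equiv.Perm (Fin n)} (hw : Vexillary w)
    (hw' : ¬ ContainsPattern w ![1, 2, 4, 3]) : BPDWithPerm w = reducedBPD w :=
  Set.ext fun _ => ⟨fun h => ⟨BPD.reduced_of_perm_avoids h hw hw', h⟩, fun h => h.2⟩

end BumplessPipeDream

theorem mainTheorem4 (n : ℕ) (w : Equiv.Perm (Fin n)) :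
    (BumplessPipeDream.Vexillary w →
      BumplessPipeDream.BPDWithType w = BumplessPipeDream.reducedBPD w) ∧
    (BumplessPipeDream.Vexillary w →
      ¬ BumplessPipeDream.ContainsPattern w ![1, 2, 4, 3] →
      BumplessPipeDream.BPDWithPerm w = BumplessPipeDream.BPDWithType w ∧
      BumplessPipeDream.BPDWithType w = BumplessPipeDream.reducedBPD w) :=
  ⟨fun hw => BumplessPipeDream.BPDWithType_eq_reducedBPD hw, fun hw hw' =>
    ⟨(BumplessPipeDream.BPDWithPerm_eq_reducedBPD hw hw').trans
      (BumplessPipeDream.BPDWithType_eq_reducedBPD hw).symm,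
    BumplessPipeDream.BPDWithType_eq_reducedBPD hw⟩⟩
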